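/- **Setting.** An MV-algebra is a commutative monoid $(M,\oplus,0)$ with a complement $\overline{(\cdot)}:M\to M$ such that $\overline{\overline{x}}=x$, $x\oplus\overline{0}=\overline{0}$ and $\overline{(\overline{x}\oplus y)}\oplus y=\overline{(\overline{y}\oplus x)}\oplus x$. Put $x\ominus y=\overline{\overline{x}\oplus y}$ and $x\sqsubseteq y$ iff $x\oplus z=y$ for some $z$. It is a complete MV-chain if $\sqsubseteq$ is total and a complete lattice. Let $\mathbb{M}$ be a complete MV-chain and $Y$ a finite set; order $\mathbb{M}^Y$ pointwise and write $a\sqsubset b$ for $a\sqsubseteq b$, $a\ne b$. Let $\|a\|=\max_{y\in Y}a(y)$ (which is $0$ if $Y=\emptyset$). A function $f:\mathbb{M}^Y\to\mathbb{M}^Y$ is non-expansive if $\|f(b)\ominus f(a)\|\sqsubseteq\|b\ominus a\|$ for all $a,b\in\mathbb{M}^Y$. For a monotone endofunction $g$ of a complete lattice, $\mu g$ and $\nu g$ are its least and greatest fixpoints, and a pre-fixpoint of $g$ is an $l$ with $g(l)\sqsubseteq l$. A min-decomposition of $f$ assigns to each $y\in Y$ a finite set $H_{\min}(y)$ of monotone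 functions $\mathbb{M}^Y\to\mathbb{M}$ such that $f(a)(y)=\min_{h\in H_{\min}(y)}h(a)$ for all $a\in\mathbb{M}^Y$ and $y\in Y$. A strategy is a map $C$ with $C(y)\in H_{\min}(y)$ for all $y\in Y$; put $f_C(a)(y)=C(y)(a)$. A strategy $C'$ is a min-improvement of $C$ if $f_{C'}(\mu f_C)\sqsubset\mu f_C$. For $S\subseteq Y$ and $\delta\in\mathbb{M}$, let $\delta_S\in\mathbb{M}^Y$ have the value $\delta$ on $S$ and $0$ elsewhere. For $a\in\mathbb{M}^Y$ let $$f_\#^{a,\delta}(S)=\{y\in Y \mid f(a)(y)\neq 0,\ f(a)(y)\ominus f(a\ominus\delta_S)(y)\sqsupseteq\delta\},$$ and let $f_\#^a(S)$ be the common value of $f_\#^{a,\delta}(S)$ for all sufficiently small $\delta\sqsupset 0$ (precisely, $y\in f_\#^a(S)$ iff there is $\iota\sqsupset 0$ such that $y\in f_\#^{a,\delta}(S)$ for all $0\sqsubset\delta\sqsubseteq\iota$). **Algorithm.** Start with any strategy $C_0$ and $i=0$, and iterate: 1. Determine $\mu f_{C_i}$. 2. If $C_i$ has a min-improvement, let $C_{i+1}$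 be any min-improvement of $C_i$; increase $i$ and repeat. 3. Otherwise, if $\mu f_{C_i}\neq\mu f$, choose any pre-fixpoint $a\sqsubset\mu f_{C_i}$ of $f$ and, for each $y\in Y$, let $C_{i+1}(y)$ be any $h\in H_{\min}(y)$ minimising $h(a)$; increase $i$ and repeat. 4. Otherwise stop and output $\mu f_{C_i}$. **Theorem.** Let $Y$ be a finite set, $\mathbb{M}$ a complete MV-chain, $f:\mathbb{M}^Y\to\mathbb{M}^Y$ a non-expansive function and $H_{\min}$ a min-decomposition of $f$. Then the algorithm terminates and computes $\mu f$. More precisely: a strategy exists; there is no infinite run, whatever $C_0$ is and whatever choices are made; every iteration can be carried out, so that a run ends only in step 4; and when it ends, the output is the least fixpoint $\mu f$ of $f$. Moreover, if a strategy $C$ has no min-improvement, then $a:=\mu f_C$ is a fixpoint of $f$; the test in step 3 can be decided by means of $\nu f_\#^a$, since $a\neq\mu f$ if and only if $\nu f_\#^a\neq\emptyset$; and if $\nu f_\#^a\neq\emptyset$, there is $\delta\in\mathbb{M}$, $\delta\sqsupset 0$, such that $a\ominus\delta_{\nu f_\#^a}\sqsubset a$ is a pre-fixpoint of $f$, so that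 it can be chosen in step 3. -/

import Mathlib

namespace StrategyIteration

/-- MV-algebras: a commutative monoid (written additively, `+` is the operation `⊕`)
with a complement satisfying the three MV-axioms. -/
class MVAlgebra (M : Type*) extends AddCommMonoid M where
  comp : M → M
  comp_comp : ∀ x : M, comp (comp x) = x
  add_comp_zero : ∀ x : M, x + comp 0 = comp 0
  comp_comp_add_add : ∀ x y : M, comp (comp x + y) + y = comp (comp y + x) + x

/-- Complete MV-chains: MV-algebras whose natural order (`x ≤ y` iff `x ⊕ z = y` for some `z`)
is total and a complete lattice. -/
class CompleteMVChain (M : Type*) extends MVAlgebra M, CompleteLattice M where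
  le_iff_exists_add_eq : ∀ x y : M, x ≤ y ↔ ∃ z, x + z = y
  le_or_le : ∀ x y : M, x ≤ y ∨ y ≤ x

/-- The MV-subtraction `x ⊖ y`, the complement of `comp x ⊕ y`.
On functions into `M` it is taken pointwise. -/
instance (M : Type*) [CompleteMVChain M] : Sub M :=
  ⟨fun x y => MVAlgebra.comp (MVAlgebra.comp x + y)⟩

section Fixpoints

variable {L : Type*} [CompleteLattice L]

/-- `μ g`: the meet of all pre-fixpoints. -/
def mu (g : L → L) : L := sInf {l | g l ≤ l}

/-- `ν g`: the join of all post-fixpoints. -/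
def nu (g : L → L) : L := sSup {l | l ≤ g l}

theorem isLeast_mu {g : L → L} (hg : Monotone g) : IsLeast (Function.fixedPoints g) (mu g) :=
  OrderHom.isLeast_lfp ⟨g, hg⟩

theorem isGreatest_nu {g : L → L} (hg : Monotone g) :
    IsGreatest (Function.fixedPoints g) (nu g) :=
  OrderHom.isGreatest_gfp ⟨g, hg⟩

end Fixpoints

section Chain

variable {M : Type*} [CompleteMVChain M] {Y : Type*}

/-- The norm of `a : M^Y`. For finite `Y` the supremum is the maximum of the values of `a`
(and it is `0` if `Y` is empty). -/
def supNorm (a : Y → M) : M := ⨆ y, a y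

/-- Non-expansive endofunctions of `M^Y`. -/
def NonExpansive (f : (Y → M) → (Y → M)) : Prop :=
  ∀ a b : Y → M, supNorm (f b - f a) ≤ supNorm (b - a)

/-- `a ⊖ δ_S`: decrease `a` by `δ` on the set `S`. -/
noncomputable def decreaseOn (a : Y → M) (δ : M) (S : Set Y) : Y → M :=
  a - S.indicator (fun _ => δ)

/-- `f_#^{a,δ}(S)`: the points `y` with `f(a)(y) ≠ 0` at which `f(a)` and `f(a ⊖ δ_S)` differ by
at least `δ`. Points of `S` at which `a` vanishes have no influence, and the values are subsets of
`{y | f(a)(y) ≠ 0}`. -/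
def approxAt (f : (Y → M) → (Y → M)) (a : Y → M) (δ : M) (S : Set Y) : Set Y :=
  {y | f a y ≠ 0 ∧ δ ≤ f a y - f (decreaseOn a δ S) y}

/-- The `a`-approximation `f_#^a`: the common value of `f_#^{a,δ}` for all sufficiently
small `δ` above `0`. -/
def approx (f : (Y → M) → (Y → M)) (a : Y → M) (S : Set Y) : Set Y :=
  {y | ∃ ι : M, 0 < ι ∧ ∀ δ : M, 0 < δ → δ ≤ ι → y ∈ approxAt f a δ S}

/-- `H` is a min-decomposition of `f`: each `H y` is a finite set of monotone functions and
`f(a)(y)` is the minimum of `h(a)` for `h ∈ H y`. -/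
structure IsMinDecomposition (f : (Y → M) → (Y → M)) (H : Y → Finset ((Y → M) → M)) : Prop where
  monotone : ∀ y, ∀ h ∈ H y, Monotone h
  isLeast : ∀ (a : Y → M) (y : Y), IsLeast {m | ∃ h ∈ H y, h a = m} (f a y)

/-- Strategies choose an element of `H y` for each `y`. -/
abbrev Strategy (H : Y → Finset ((Y → M) → M)) : Type _ :=
  {C : Y → ((Y → M) → M) // ∀ y, C y ∈ H y}

variable {H : Y → Finset ((Y → M) → M)}

/-- The function `f_C` obtained by fixing the strategy `C`. -/
def Strategy.fn (C : Strategy H) : (Y → M) → (Y → M) := fun a y => C.1 y a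

/-- The set of min-improvements of `C`. -/
def minImprovements (C : Strategy H) : Set (Strategy H) :=
  {C' | C'.fn (mu C.fn) < mu C.fn}

/-- One iteration of strategy iteration from above, moving from the strategy `C` to a new one.
All choices that the algorithm leaves open are left open. -/
inductive Step (f : (Y → M) → (Y → M)) (C C' : Strategy H) : Prop
  /-- If there are min-improvements, move to any one of them. -/
  | improve (h : C' ∈ minImprovements C)
  /-- Otherwise, if `μ f_C ≠ μ f`, take any pre-fixpoint `a` of `f` strictly below `μ f_C` and
  let `C' y` be any minimiser of `h(a)` for `h ∈ H y`. -/
  | drop (hC : minImprovements C = ∅) (hne : mu C.fn ≠ mu f) (a : Y → M)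
      (ha : a < mu C.fn) (hpre : f a ≤ a) (hmin : ∀ y, ∀ h ∈ H y, C'.1 y a ≤ h a)

/-- The remaining case, in which the algorithm stops and outputs `μ f_C`. -/
def Stops (f : (Y → M) → (Y → M)) (C : Strategy H) : Prop :=
  minImprovements C = ∅ ∧ ¬ mu C.fn ≠ mu f

end Chain

end StrategyIteration

open StrategyIteration

/-! Every step strictly lowers `mu C.fn` (`mu_lt_of_step`), and there are finitely many strategies,
so no run is infinite. If `C` has no min-improvement, a strategy optimal at `a = mu C.fn` shows `f a
= a`. If moreover `b = mu f < a`, let `S` be the set where `a - b` attains its maximum. Lowering `a`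
on `S` by a small `δ` brings it closer to `b` by `δ`; by non-expansiveness `f` of it is as close to
`b`, so `f` drops by at least `δ` on `S`. Hence `S ⊆ approx f a S`, and conversely such a nonempty
`S` gives a pre-fixpoint below `a`. -/

namespace StrategyIteration

/-! ### Arithmetic of MV-chains -/

section MVChain

variable {M : Type*} [CompleteMVChain M]

open MVAlgebra

theorem comp_add_self (x : M) : comp x + x = comp 0 := by
  have h := comp_comp_add_add x (comp (0 : M))
  rw [add_comp_zero, comp_comp, zero_add] at h
  exact h.symm

theorem sub_eq (x y : M) : x - y = comp (comp x + y) := rfl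

theorem comp_sub (x y : M) : comp (x - y) = comp x + y := by
  rw [sub_eq, comp_comp]

theorem le_iff_comp_add_eq (x y : M) : x ≤ y ↔ comp x + y = comp 0 := by
  rw [CompleteMVChain.le_iff_exists_add_eq]
  constructor
  · rintro ⟨z, rfl⟩
    rw [← add_assoc, comp_add_self, add_comm, add_comp_zero]
  · intro h
    have h' := comp_comp_add_add x y
    rw [h, comp_comp, zero_add] at h'
    exact ⟨comp (comp y + x), by rw [add_comm, ← h']⟩

/-- The MV-subtraction is residual to the sum. -/
theorem sub_le_iff (x y z : M) : x - y ≤ z ↔ x ≤ y + z := by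
  rw [le_iff_comp_add_eq, le_iff_comp_add_eq, comp_sub, add_assoc]

theorem zero_le_chain (x : M) : 0 ≤ x :=
  (CompleteMVChain.le_iff_exists_add_eq 0 x).2 ⟨x, zero_add x⟩

theorem chain_le_zero_iff {x : M} : x ≤ 0 ↔ x = 0 :=
  ⟨fun h => le_antisymm h (zero_le_chain x), fun h => h.le⟩

theorem chain_pos_iff {x : M} : 0 < x ↔ x ≠ 0 :=
  ⟨fun h => h.ne', fun h => lt_of_le_of_ne (zero_le_chain x) h.symm⟩

theorem sub_eq_zero_iff {x y : M} : x - y = 0 ↔ x ≤ y := by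
  rw [← chain_le_zero_iff, sub_le_iff, add_zero]

theorem sub_pos_of_not_le {x y : M} (h : ¬ x ≤ y) : 0 < x - y :=
  chain_pos_iff.2 fun h' => h (sub_eq_zero_iff.1 h')

theorem chain_add_le_add_right {x y : M} (h : x ≤ y) (z : M) : x + z ≤ y + z := by
  obtain ⟨w, rfl⟩ := (CompleteMVChain.le_iff_exists_add_eq x y).1 h
  exact (CompleteMVChain.le_iff_exists_add_eq _ _).2 ⟨w, add_right_comm x z w⟩

theorem sub_le_self_chain (x y : M) : x - y ≤ x := by
  rw [sub_le_iff]
  exact (CompleteMVChain.le_iff_exists_add_eq _ _).2 ⟨y, add_comm x y⟩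

theorem chain_sub_zero (x : M) : x - 0 = x := by
  rw [sub_eq, add_zero, comp_comp]

theorem sub_le_sub_left_chain {y z : M} (h : y ≤ z) (x : M) : x - z ≤ x - y := by
  rw [sub_le_iff]
  exact ((sub_le_iff x y _).1 le_rfl).trans (chain_add_le_add_right h _)

theorem sub_sub_eq_sub_add (x y z : M) : x - y - z = x - (y + z) := by
  rw [sub_eq (x - y), comp_sub, sub_eq, add_assoc]

theorem sub_right_comm_chain (x y z : M) : x - y - z = x - z - y := by
  rw [sub_sub_eq_sub_add, add_comm, sub_sub_eq_sub_add]

/-- The third axiom, applied to complements, says that `x - (x - z)` is symmetric in `x` and `z`. -/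
theorem sub_sub_cancel_chain {x z : M} (h : z ≤ x) : x - (x - z) = z := by
  have h' := comp_comp_add_add (comp z) (comp x)
  rw [comp_comp, comp_comp, add_comm x, (le_iff_comp_add_eq z x).1 h, comp_comp, zero_add] at h'
  rw [sub_eq, sub_eq, add_comm (comp x) z, add_comm, h', comp_comp]

theorem le_sub_comm_of_le {x y z : M} (hz : z ≤ x) (h : y ≤ x - z) : z ≤ x - y :=
  (sub_sub_cancel_chain hz).symm.le.trans (sub_le_sub_left_chain h x)

theorem sub_ne_self {x y : M} (hx : x ≠ 0) (hy : y ≠ 0) : x - y ≠ x := by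
  intro h
  rcases CompleteMVChain.le_or_le x y with hxy | hyx
  · exact hx (h.symm.trans (sub_eq_zero_iff.2 hxy))
  · have h' := sub_sub_cancel_chain hyx
    rw [h, sub_eq_zero_iff.2 le_rfl] at h'
    exact hy h'.symm

/-- A finite minimum in a chain; `c` covers an empty index type. -/
theorem exists_pos_le {ι : Type*} [Finite ι] (e : ι → M) (he : ∀ i, 0 < e i) {c : M}
    (hc : 0 < c) : ∃ d : M, 0 < d ∧ d ≤ c ∧ ∀ i, d ≤ e i := by
  classical
  cases nonempty_fintype ι
  suffices ∀ s : Finset ι, ∃ d : M, 0 < d ∧ d ≤ c ∧ ∀ i ∈ s, d ≤ e i by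
    simpa using this Finset.univ
  intro s
  induction s using Finset.induction_on with
  | empty => exact ⟨c, hc, le_rfl, by simp⟩
  | insert i s _ ih =>
    obtain ⟨d, hd, hdc, hds⟩ := ih
    rcases CompleteMVChain.le_or_le d (e i) with h | h
    · exact ⟨d, hd, hdc, by simpa using ⟨h, hds⟩⟩
    · exact ⟨e i, he i, h.trans hdc, by simpa using fun j hj => h.trans (hds j hj)⟩

theorem exists_supNorm_eq {Y : Type*} [Finite Y] [Nonempty Y] (e : Y → M) :
    ∃ y, e y = supNorm e := by
  obtain ⟨_, ⟨y, rfl⟩, hy⟩ := (Set.finite_range e).exists_maximal (Set.range_nonempty e)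
  refine ⟨y, le_antisymm (le_iSup e y) (iSup_le fun z => ?_)⟩
  rcases CompleteMVChain.le_or_le (e z) (e y) with h | h
  · exact h
  · exact hy ⟨z, rfl⟩ h

end MVChain

/-! ### Approximations and smaller pre-fixpoints -/

section Approximation

variable {M : Type*} [CompleteMVChain M] {Y : Type*} {f : (Y → M) → (Y → M)}

theorem NonExpansive.monotone (hf : NonExpansive f) : Monotone f := by
  intro a b hab y
  have h : supNorm (a - b) ≤ 0 := iSup_le fun z => (sub_eq_zero_iff.2 (hab z)).le
  exact sub_eq_zero_iff.1 (chain_le_zero_iff.1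
    ((le_iSup (f a - f b) y).trans ((hf b a).trans h)))

theorem decreaseOn_of_mem (a : Y → M) (δ : M) {S : Set Y} {y : Y} (hy : y ∈ S) :
    decreaseOn a δ S y = a y - δ := by
  simp [decreaseOn, hy]

theorem decreaseOn_of_notMem (a : Y → M) (δ : M) {S : Set Y} {y : Y} (hy : y ∉ S) :
    decreaseOn a δ S y = a y := by
  simp [decreaseOn, hy, chain_sub_zero]

theorem decreaseOn_le (a : Y → M) (δ : M) (S : Set Y) : decreaseOn a δ S ≤ a :=
  fun _ => sub_le_self_chain _ _

theorem decreaseOn_anti (a : Y → M) (δ : M) {S T : Set Y} (h : S ⊆ T) :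
    decreaseOn a δ T ≤ decreaseOn a δ S := by
  intro y
  by_cases hy : y ∈ S
  · rw [decreaseOn_of_mem a δ hy, decreaseOn_of_mem a δ (h hy)]
  · rw [decreaseOn_of_notMem a δ hy]
    exact decreaseOn_le a δ T y

theorem approx_monotone (hf : Monotone f) (a : Y → M) : Monotone (approx f a) := by
  rintro S T h y ⟨ι, hι, hy⟩
  refine ⟨ι, hι, fun δ hδ hδι => ⟨(hy δ hδ hδι).1, (hy δ hδ hδι).2.trans ?_⟩⟩
  exact sub_le_sub_left_chain (hf (decreaseOn_anti a δ h) y) _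

/-- Below a fixpoint `a`, a nonempty post-fixpoint `S` of the `a`-approximation yields a smaller
pre-fixpoint. -/
theorem exists_decreaseOn_isPrefixpoint [Finite Y] (hf : Monotone f) {a : Y → M} (ha : f a = a)
    {S : Set Y} (hS : S ⊆ approx f a S) (hne : S.Nonempty) :
    ∃ δ : M, 0 < δ ∧ decreaseOn a δ S < a ∧ f (decreaseOn a δ S) ≤ decreaseOn a δ S := by
  obtain ⟨y₀, hy₀⟩ := hne
  choose ι hι hδ using fun y : S => hS y.2
  obtain ⟨δ, hδ0, -, hδι⟩ := exists_pos_le ι hι (hι ⟨y₀, hy₀⟩)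
  have key : ∀ y ∈ S, y ∈ approxAt f a δ S := fun y hy => hδ ⟨y, hy⟩ δ hδ0 (hδι ⟨y, hy⟩)
  refine ⟨δ, hδ0, lt_of_le_of_ne (decreaseOn_le a δ S) fun h => ?_, fun y => ?_⟩
  · have h₀ := congrFun h y₀
    rw [decreaseOn_of_mem a δ hy₀] at h₀
    -- The clause `f a y ≠ 0` of `approxAt` makes the decrease strict.
    exact sub_ne_self (ha ▸ (key y₀ hy₀).1) hδ0.ne' h₀
  · have hle : f (decreaseOn a δ S) y ≤ f a y := hf (decreaseOn_le a δ S) y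
    by_cases hy : y ∈ S
    · have h := le_sub_comm_of_le hle (key y hy).2
      rw [decreaseOn_of_mem a δ hy]
      rwa [ha] at h
    · rw [decreaseOn_of_notMem a δ hy]
      rwa [ha] at hle

/-- If `b < a` are fixpoints, the points at which `a ⊖ b` is maximal form a nonempty post-fixpoint
of the `a`-approximation. -/
theorem exists_nonempty_subset_approx [Finite Y] (hf : NonExpansive f) {a b : Y → M}
    (ha : f a = a) (hb : f b = b) (hba : b < a) :
    ∃ S : Set Y, S.Nonempty ∧ S ⊆ approx f a S := by
  obtain ⟨w, hw⟩ : ∃ w, ¬ a w ≤ b w := by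
    by_contra! h
    exact hba.not_ge h
  have : Nonempty Y := ⟨w⟩
  obtain ⟨x, hx⟩ := exists_supNorm_eq (a - b)
  set m := supNorm (a - b) with hm
  have hle : ∀ z, a z - b z ≤ m := le_iSup (a - b)
  have hm0 : 0 < m := (sub_pos_of_not_le hw).trans_le (hle w)
  set S : Set Y := {y | a y - b y = m} with hS
  -- `ι` is at most the gap between `m` and each difference off `S`, so those points stay within `m
  -- - δ`; `ι ≤ m` gives `m - (m - δ) = δ`.
  obtain ⟨ι, hι0, hιm, hι⟩ := exists_pos_le (fun z : (Sᶜ : Set Y) => m - (a z - b z))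
    (fun z => sub_pos_of_not_le fun h => z.2 (le_antisymm (hle z) h)) hm0
  refine ⟨S, ⟨x, hx⟩, fun y hy => ⟨ι, hι0, fun δ hδ0 hδι => ⟨?_, ?_⟩⟩⟩
  · rw [ha]
    exact chain_pos_iff.1 (hm0.trans_le ((show a y - b y = m from hy) ▸ sub_le_self_chain _ _))
  · have hnorm : supNorm (decreaseOn a δ S - b) ≤ m - δ := by
      refine iSup_le fun z => ?_
      rw [Pi.sub_apply]
      by_cases hz : z ∈ S
      · rw [decreaseOn_of_mem a δ hz, sub_right_comm_chain, show a z - b z = m from hz]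
      · rw [decreaseOn_of_notMem a δ hz]
        exact le_sub_comm_of_le (hle z) (hδι.trans (hι ⟨z, hz⟩))
    have hfy : f (decreaseOn a δ S) y - b y ≤ m - δ := by
      have h := (le_iSup (f (decreaseOn a δ S) - f b) y).trans ((hf b _).trans hnorm)
      rwa [Pi.sub_apply, hb] at h
    rw [ha]
    calc δ = m - (m - δ) := (sub_sub_cancel_chain (hδι.trans hιm)).symm
      _ = a y - (b y + (m - δ)) := by
        rw [← sub_sub_eq_sub_add, show a y - b y = m from hy]
      _ ≤ a y - f (decreaseOn a δ S) y := sub_le_sub_left_chain ((sub_le_iff _ _ _).1 hfy) _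

theorem mu_le_of_isPrefixpoint {L : Type*} [CompleteLattice L] {g : L → L} {l : L} (h : g l ≤ l) :
    mu g ≤ l :=
  sInf_le h

theorem ne_mu_iff_nu_approx_ne_empty [Finite Y] (hf : NonExpansive f) {a : Y → M} (ha : f a = a) :
    a ≠ mu f ↔ nu (approx f a) ≠ ∅ := by
  constructor
  · intro hne h
    obtain ⟨S, hS, hSf⟩ := exists_nonempty_subset_approx hf ha (isLeast_mu hf.monotone).1
      (lt_of_le_of_ne (mu_le_of_isPrefixpoint ha.le) hne.symm)
    have hle : S ≤ nu (approx f a) := le_sSup hSf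
    rw [h] at hle
    exact hS.ne_empty (Set.subset_empty_iff.1 hle)
  · rintro hne rfl
    obtain ⟨δ, -, hlt, hpre⟩ := exists_decreaseOn_isPrefixpoint hf.monotone ha
      (isGreatest_nu (approx_monotone hf.monotone (mu f))).1.ge (Set.nonempty_iff_ne_empty.2 hne)
    exact hlt.not_ge (mu_le_of_isPrefixpoint hpre)

end Approximation

/-! ### Progress and termination of the algorithm -/

section Strategies

variable {M : Type*} [CompleteMVChain M] {Y : Type*} {f : (Y → M) → (Y → M)}
  {H : Y → Finset ((Y → M) → M)}

instance [Finite Y] : Finite (Strategy H) :=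
  Finite.of_injective (fun (C : Strategy H) y => (⟨C.1 y, C.2 y⟩ : H y)) fun _ _ h =>
    Subtype.ext (funext fun y => congrArg Subtype.val (congrFun h y))

theorem IsMinDecomposition.fn_monotone (hH : IsMinDecomposition f H) (C : Strategy H) :
    Monotone C.fn :=
  fun _ _ h y => hH.monotone y _ (C.2 y) h

theorem IsMinDecomposition.le_fn (hH : IsMinDecomposition f H) (C : Strategy H) (a : Y → M) :
    f a ≤ C.fn a :=
  fun y => (hH.isLeast a y).2 ⟨_, C.2 y, rfl⟩

/-- A strategy that is optimal at `a`. -/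
theorem IsMinDecomposition.exists_fn_eq (hH : IsMinDecomposition f H) (a : Y → M) :
    ∃ C : Strategy H, C.fn a = f a := by
  choose C hC hCa using fun y => (hH.isLeast a y).1
  exact ⟨⟨C, hC⟩, funext hCa⟩

theorem IsMinDecomposition.mu_le (hH : IsMinDecomposition f H) (C : Strategy H) :
    mu f ≤ mu C.fn :=
  mu_le_of_isPrefixpoint ((hH.le_fn C _).trans (isLeast_mu (hH.fn_monotone C)).1.le)

theorem IsMinDecomposition.mu_lt_of_step (hH : IsMinDecomposition f H) {C C' : Strategy H}
    (h : Step f C C') : mu C'.fn < mu C.fn := by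
  cases h with
  | improve h =>
    have h : C'.fn (mu C.fn) < mu C.fn := h
    -- Were the least fixpoints equal, `mu C.fn` would be fixed by `C'.fn`.
    refine lt_of_le_of_ne (mu_le_of_isPrefixpoint h.le) fun heq => h.ne ?_
    rw [← heq]
    exact (isLeast_mu (hH.fn_monotone C')).1
  | drop _ _ a ha hpre hmin =>
    refine lt_of_le_of_lt (mu_le_of_isPrefixpoint fun y => ?_) ha
    obtain ⟨h, hh, hy⟩ := (hH.isLeast a y).1
    exact (hmin y h hh).trans (hy.le.trans (hpre y))

theorem IsMinDecomposition.apply_mu_eq (hH : IsMinDecomposition f H) {C : Strategy H}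
    (hC : minImprovements C = ∅) : f (mu C.fn) = mu C.fn := by
  obtain ⟨C', hC'⟩ := hH.exists_fn_eq (mu C.fn)
  by_contra hne
  have hlt : C'.fn (mu C.fn) < mu C.fn := by
    rw [hC']
    exact lt_of_le_of_ne ((hH.le_fn C _).trans (isLeast_mu (hH.fn_monotone C)).1.le) hne
  exact (Set.eq_empty_iff_forall_notMem.1 hC) C' hlt

theorem IsMinDecomposition.stops_iff (hf : Monotone f) (hH : IsMinDecomposition f H)
    (C : Strategy H) : Stops f C ↔ ¬ ∃ C', Step f C C' := by
  constructor
  · rintro ⟨hC, hmu⟩ ⟨C', h | ⟨-, hne, -⟩⟩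
    · exact (Set.eq_empty_iff_forall_notMem.1 hC) C' h
    · exact hmu hne
  · intro hno
    have hC : minImprovements C = ∅ :=
      Set.eq_empty_iff_forall_notMem.2 fun C' h => hno ⟨C', .improve h⟩
    refine ⟨hC, fun hne => ?_⟩
    -- `mu f` itself is an admissible pre-fixpoint for step 3.
    obtain ⟨C', hC'⟩ := hH.exists_fn_eq (mu f)
    exact hno ⟨C', .drop hC hne (mu f) (lt_of_le_of_ne (hH.mu_le C) hne.symm)
      (isLeast_mu hf).1.le fun y h hh =>
        (congrFun hC' y).trans_le ((hH.isLeast _ y).2 ⟨h, hh, rfl⟩)⟩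

theorem IsMinDecomposition.not_exists_infinite_run [Finite Y] (hH : IsMinDecomposition f H) :
    ¬ ∃ s : ℕ → Strategy H, ∀ i, Step f (s i) (s (i + 1)) := by
  rintro ⟨s, hs⟩
  have hanti : StrictAnti fun i => mu (s i).fn :=
    strictAnti_nat_of_succ_lt fun i => hH.mu_lt_of_step (hs i)
  exact not_injective_infinite_finite s fun i j h =>
    hanti.injective (congrArg (fun C : Strategy H => mu C.fn) h)

end Strategies

end StrategyIteration

theorem mainTheorem1 {M : Type*} [CompleteMVChain M] {Y : Type*} [Finite Y]
    (f : (Y → M) → (Y → M)) (hf : NonExpansive f)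
    (H : Y → Finset ((Y → M) → M)) (hH : IsMinDecomposition f H) :
    -- an initial strategy exists
    Nonempty (Strategy H) ∧
    -- termination: there is no infinite run, whatever the initial strategy and the choices made
    (¬ ∃ s : ℕ → Strategy H, ∀ i, Step f (s i) (s (i + 1))) ∧
    -- the algorithm never gets stuck: an iteration can be performed unless it stops
    (∀ C : Strategy H, Stops f C ↔ ¬ ∃ C', Step f C C') ∧
    -- whenever it stops, the output is the least fixpoint of `f`
    (∀ C : Strategy H, Stops f C →
      mu C.fn = mu f ∧ IsLeast (Function.fixedPoints f) (mu C.fn)) ∧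
    -- when there is no min-improvement left, a fixpoint of `f` has been reached; it is not the
    -- least one iff the greatest fixpoint of the approximation is non-empty, and in this case
    -- decreasing it there by some `δ` yields a smaller pre-fixpoint from which to continue
    (∀ C : Strategy H, minImprovements C = ∅ →
      mu C.fn ∈ Function.fixedPoints f ∧
      (mu C.fn ≠ mu f ↔ nu (approx f (mu C.fn)) ≠ ∅) ∧
      (nu (approx f (mu C.fn)) ≠ ∅ →
        ∃ δ : M, 0 < δ ∧
          decreaseOn (mu C.fn) δ (nu (approx f (mu C.fn))) < mu C.fn ∧
          f (decreaseOn (mu C.fn) δ (nu (approx f (mu C.fn))))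
            ≤ decreaseOn (mu C.fn) δ (nu (approx f (mu C.fn))))) := by
  refine ⟨(hH.exists_fn_eq 0).nonempty, hH.not_exists_infinite_run,
    hH.stops_iff hf.monotone, fun C hC => ?_, fun C hC => ?_⟩
  · have h := not_not.1 hC.2
    exact ⟨h, h ▸ isLeast_mu hf.monotone⟩
  · have hfix := hH.apply_mu_eq hC
    exact ⟨hfix, ne_mu_iff_nu_approx_ne_empty hf hfix, fun hne =>
      exists_decreaseOn_isPrefixpoint hf.monotone hfix
        (isGreatest_nu (approx_monotone hf.monotone _)).1.ge (Set.nonempty_iff_ne_empty.2 hne)⟩
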